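/- **Conventions.** A filtered space $(X,\mathcal S)$ of dimension $n$ is a topological space with closed subsets $\emptyset=X_{-1}\subseteq X_0\subseteq\dots\subseteq X_{n-1}\subsetneq X_n=X$. Its $i$-dimensional strata are the connected components of $X^i=X_i\setminus X_{i-1}$, of codimension $n-i$; strata of dimension $n$ are regular, the others singular. Subspaces $Y$ carry the induced filtration $Y\cap X_i$, products $Y\times X$ with a space $Y$ the filtration $Y\times X_i$ (stratification $\mathcal I\times\mathcal S$), and the open cone $\mathring cL=L\times[0,1[/L\times\{0\}$, with apex $\mathbf v$, on a compact Hausdorff filtered space $(L,\mathcal L)$ the filtration $(\mathring cL)_i=\mathring c(L_{i-1})$ with $\mathring c\emptyset=\{\mathbf v\}$ (stratification $\mathring c\mathcal L$). A stratified homeomorphism is a homeomorphism $f$ such that $f$ and $f^{-1}$ send each stratum into a stratum of at most the same codimension. We say that $(X,\mathcal S)$ has manifold strata if each $i$-dimensional stratum is an $i$-dimensional topological manifold (Hausdorff, second countable), open in $X^i$. A *CS set* of dimension $n$ is a Hausdorff filtered space of dimension $n$ with manifold strata such that every $x\in X^i$, $i<n$, has an open neighborhood $V$ in $X$ and an open neighborhood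 $U$ in $X^i$ for which there are a compact Hausdorff filtered space $(L,\mathcal L)$ of dimension $n-i-1$ and a stratified homeomorphism $\varphi\colon(U\times\mathring cL,\mathcal I\times\mathring c\mathcal L)\to(V,\mathcal S)$ with $\varphi(u,\mathbf v)=u$ for $u\in U$. Let $S$ be a singular stratum of $(X,\mathcal S)$. A *conical neighborhood* of $S$ with link $(L,\mathcal L)$, a compact Hausdorff filtered space of dimension $n-\dim S-1$, is a continuous map $\Pi\colon E\to S$ on an open neighborhood $E$ of $S$ for which there are an open cover $\mathfrak U$ of $S$ and, for each $U\in\mathfrak U$, a stratified homeomorphism $\varphi_U\colon(\Pi^{-1}(U),\mathcal S)\to(U\times\mathring cL,\mathcal I\times\mathring c\mathcal L)$ with $\mathrm{pr}_1\circ\varphi_U=\Pi$ and $\varphi_U(x)=(x,\mathbf v)$ for $x\in U$. A *pre-Thom–Mather space* is a Hausdorff filtered space with manifold strata all of whose singular strata have a conical neighborhood. A *coarsening* $(X,\mathcal S,\mathcal T)$ consists of two filtered spaces of the same dimension $n$ on the same space $X$ such that each stratum of $\mathcal T$ is a union of strata of $\mathcal S$; it is a *CS-coarsening* if $(X,\mathcal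 S)$ and $(X,\mathcal T)$ are CS sets. A singular stratum of $\mathcal S$ is *exceptional* if it is contained in a regular stratum of $\mathcal T$. Let $\mathcal S_e$ be the filtration of $X$ whose $i$-th skeleton is the union of the non-exceptional strata of $\mathcal S$ of dimension at most $i$ if $i<n$, and $X$ if $i=n$. **Proposition 6.3.** Let $(X,\mathcal S,\mathcal T)$ be a CS-coarsening such that $(X,\mathcal S)$ is a pre-Thom–Mather space. Then: 1. $(X,\mathcal S,\mathcal S_e)$ and $(X,\mathcal S_e,\mathcal T)$ are coarsenings, and the strata of $\mathcal S_e$ are exactly the unions of the classes of strata of $\mathcal S$ under the equivalence relation generated by $S\sim S'$ whenever $S$ is exceptional and $S\subseteq\overline{S'}$. 2. $(X,\mathcal S_e)$ is a pre-Thom–Mather space. 3. For $i<n$, the $i$-dimensional strata of $\mathcal S_e$ are exactly the non-exceptional $i$-dimensional strata of $\mathcal S$. In particular, every singular stratum of $\mathcal S_e$ is a singular stratum of $\mathcal S$. 4. If $S$ is a singular stratum of $\mathcal S_e$, then every conical neighborhood $\Pi\colon E\to S$ of $S$ in $(X,\mathcal S)$, with link $(L,\mathcal L)$, is also a conical neighborhood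 of $S$ in $(X,\mathcal S_e)$, with link $(L,\mathcal L')$ for some filtration $\mathcal L'$ of the same space $L$. -/

import Mathlib

open Set Topology

universe u v

/-- A filtration of a topological space `X`, of formal dimension `n`, by closed subsets
`∅ = X_{-1} ⊆ X_0 ⊆ X_1 ⊆ ... ⊆ X_n = X` (with `X_i = X` for `i ≥ n`). The condition
`X_{n-1} ≠ X` is not part of this structure, see `FilteredSpace`; without it the
filtration can be restricted to any subspace. -/
structure Filtration (X : Type u) [TopologicalSpace X] (n : ℕ) where
  skel : ℕ → Set X
  isClosed_skel : ∀ i, IsClosed (skel i)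
  mono_skel : Monotone skel
  skel_top : skel n = univ

namespace Filtration

variable {X : Type u} [TopologicalSpace X] {n : ℕ}

/-- The preceding skeleton `X_{i-1}`, which is empty for `i = 0`. -/
def prevSkel (F : Filtration X n) (i : ℕ) : Set X := {x | ∃ j, j < i ∧ x ∈ F.skel j}

/-- The layer `X^i = X_i \ X_{i-1}`. -/
def layer (F : Filtration X n) (i : ℕ) : Set X := F.skel i \ F.prevSkel i

/-- `A` is an `i`-dimensional stratum: a (non-empty) connected component of `X^i`. -/
def IsStratum (F : Filtration X n) (i : ℕ) (A : Set X) : Prop :=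
  ∃ x ∈ F.layer i, A = connectedComponentIn (F.layer i) x

theorem isClosed_prevSkel (F : Filtration X n) (i : ℕ) : IsClosed (F.prevSkel i) := by
  have h : F.prevSkel i = ⋃ j ∈ Set.Iio i, F.skel j := by
    ext x; simp [prevSkel]
  rw [h]
  exact (Set.finite_Iio i).isClosed_biUnion fun j _ => F.isClosed_skel j

theorem skel_eq_univ (F : Filtration X n) {i : ℕ} (h : n ≤ i) : F.skel i = univ :=
  univ_subset_iff.1 (F.skel_top ▸ F.mono_skel h)

theorem exists_isStratum (F : Filtration X n) {i : ℕ} {x : X} (hx : x ∈ F.skel i) :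
    ∃ j ≤ i, ∃ A, F.IsStratum j A ∧ x ∈ A := by
  classical
  have hex : ∃ j, x ∈ F.skel j := ⟨i, hx⟩
  have hl : x ∈ F.layer (Nat.find hex) :=
    ⟨Nat.find_spec hex, fun ⟨j, hj, hxj⟩ => Nat.find_min hex hj hxj⟩
  exact ⟨Nat.find hex, Nat.find_min' hex hx, _, ⟨x, hl, rfl⟩, mem_connectedComponentIn hl⟩

theorem IsStratum.subset_layer {F : Filtration X n} {i : ℕ} {A : Set X}
    (h : F.IsStratum i A) : A ⊆ F.layer i := by
  obtain ⟨x, _, rfl⟩ := h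
  exact connectedComponentIn_subset _ _

/-- Strata have dimension at most `n`, so that the codimension `n - i` is not truncated. -/
theorem IsStratum.le {F : Filtration X n} {i : ℕ} {A : Set X} (h : F.IsStratum i A) :
    i ≤ n := by
  obtain ⟨x, hx, _⟩ := h
  by_contra hlt
  exact hx.2 ⟨n, not_le.1 hlt, F.skel_top ▸ mem_univ x⟩

/-- The induced filtration on a subspace, `Y_i = Y ∩ X_i`. -/
def induced (F : Filtration X n) (Y : Set X) : Filtration Y n where
  skel i := Subtype.val ⁻¹' F.skel i
  isClosed_skel i := (F.isClosed_skel i).preimage continuous_subtype_val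
  mono_skel _ _ h := preimage_mono (F.mono_skel h)
  skel_top := by rw [F.skel_top, preimage_univ]

/-- The product filtration, `(Y × X)_i = Y × X_i`. -/
def prod (Y : Type v) [TopologicalSpace Y] (F : Filtration X n) : Filtration (Y × X) n where
  skel i := Prod.snd ⁻¹' F.skel i
  isClosed_skel i := (F.isClosed_skel i).preimage continuous_snd
  mono_skel _ _ h := preimage_mono (F.mono_skel h)
  skel_top := by rw [F.skel_top, preimage_univ]

/-- A stratified map: a continuous map sending each stratum into a stratum of at most the
same codimension. -/
def IsStratifiedMap {Y : Type v} [TopologicalSpace Y] {m : ℕ} (F : Filtration X n)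
    (G : Filtration Y m) (f : X → Y) : Prop :=
  Continuous f ∧ ∀ i A, F.IsStratum i A →
    ∃ j B, G.IsStratum j B ∧ f '' A ⊆ B ∧ m - j ≤ n - i

/-- A stratified homeomorphism: both the map and its inverse are stratified. -/
def IsStratifiedHomeo {Y : Type v} [TopologicalSpace Y] {m : ℕ} (F : Filtration X n)
    (G : Filtration Y m) (f : X ≃ₜ Y) : Prop :=
  F.IsStratifiedMap G f ∧ G.IsStratifiedMap F f.symm

end Filtration

/-- A filtered space of formal dimension `n`: a filtration with `X_{n-1} ≠ X`
(in particular, `X` is non-empty). -/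
structure FilteredSpace (X : Type u) [TopologicalSpace X] (n : ℕ) extends Filtration X n where
  prevSkel_ne : toFiltration.prevSkel n ≠ univ

/-! ### The open cone -/

/-- The relation collapsing `L × {0}` to a point in `L × [0,1[`. -/
def coneSetoid (L : Type u) : Setoid (L × Set.Ico (0 : ℝ) 1) where
  r p q := p = q ∨ ((p.2 : ℝ) = 0 ∧ (q.2 : ℝ) = 0)
  iseqv :=
    { refl := fun _ => Or.inl rfl
      symm := by
        rintro p q (h | h)
        · exact Or.inl h.symm
        · exact Or.inr ⟨h.2, h.1⟩
      trans := by
        rintro p q r (rfl | h) (rfl | h')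
        · exact Or.inl rfl
        · exact Or.inr h'
        · exact Or.inr h
        · exact Or.inr ⟨h.1, h'.2⟩ }

/-- The open cone `L × [0,1[ / L × {0}` on a (non-empty) space `L`. -/
def OpenCone (L : Type u) : Type u := Quotient (coneSetoid L)

namespace OpenCone

variable {L : Type u}

/-- The point `[l, t]` of the open cone. -/
def mk (p : L × Set.Ico (0 : ℝ) 1) : OpenCone L := Quotient.mk (coneSetoid L) p

instance [TopologicalSpace L] : TopologicalSpace (OpenCone L) :=
  inferInstanceAs (TopologicalSpace (Quotient (coneSetoid L)))

/-- The apex `[-, 0]` of the open cone. -/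
noncomputable def apex [Nonempty L] : OpenCone L :=
  mk (Classical.arbitrary L, ⟨0, by norm_num, by norm_num⟩)

theorem mk_eq_mk {p q : L × Set.Ico (0 : ℝ) 1} :
    mk p = mk q ↔ p = q ∨ ((p.2 : ℝ) = 0 ∧ (q.2 : ℝ) = 0) :=
  Quotient.eq (r := coneSetoid L)

end OpenCone

/-- The cone filtration, `(cL)_i = c(L_{i-1})`, where the cone on the empty set is the apex. -/
def Filtration.cone {L : Type u} [TopologicalSpace L] {n : ℕ} (F : Filtration L n) :
    Filtration (OpenCone L) (n + 1) where
  skel i := {z | ∃ p : L × Set.Ico (0 : ℝ) 1,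
    z = OpenCone.mk p ∧ ((p.2 : ℝ) = 0 ∨ p.1 ∈ F.prevSkel i)}
  isClosed_skel i := by
    have hq : IsQuotientMap (OpenCone.mk : L × Set.Ico (0 : ℝ) 1 → OpenCone L) :=
      isQuotientMap_quot_mk
    rw [← hq.isClosed_preimage]
    have h : (OpenCone.mk ⁻¹' {z : OpenCone L | ∃ p : L × Set.Ico (0 : ℝ) 1,
        z = OpenCone.mk p ∧ ((p.2 : ℝ) = 0 ∨ p.1 ∈ F.prevSkel i)}) =
        {p : L × Set.Ico (0 : ℝ) 1 | (p.2 : ℝ) = 0} ∪ Prod.fst ⁻¹' F.prevSkel i := by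
      ext p
      constructor
      · rintro ⟨q, hpq, hq⟩
        rcases OpenCone.mk_eq_mk.1 hpq with rfl | h0
        · exact hq
        · exact Or.inl h0.1
      · intro hp
        exact ⟨p, rfl, hp⟩
    rw [h]
    exact (isClosed_eq (continuous_subtype_val.comp continuous_snd) continuous_const).union
      ((F.isClosed_prevSkel i).preimage continuous_fst)
  mono_skel := by
    rintro i j hij z ⟨p, hz, hp⟩
    refine ⟨p, hz, hp.imp_right ?_⟩
    rintro ⟨k, hk, hpk⟩
    exact ⟨k, hk.trans_le hij, hpk⟩
  skel_top := by
    refine eq_univ_of_forall fun z => ?_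
    obtain ⟨p, rfl⟩ := Quotient.exists_rep z
    exact ⟨p, rfl, Or.inr ⟨n, Nat.lt_succ_self n, F.skel_top ▸ mem_univ _⟩⟩

/-! ### CS sets and pre-Thom–Mather spaces -/

/-- `M` is a topological manifold of dimension `d`. -/
def IsTopologicalManifold (M : Type u) [TopologicalSpace M] (d : ℕ) : Prop :=
  T2Space M ∧ SecondCountableTopology M ∧ Nonempty (ChartedSpace (EuclideanSpace ℝ (Fin d)) M)

namespace FilteredSpace

variable {X : Type u} [TopologicalSpace X] {n : ℕ}

/-- For each `i`, the `i`-dimensional strata are `i`-dimensional topological manifolds, and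
`X^i` is their topological disjoint union, i.e. they are open in `X^i`. -/
def HasManifoldStrata (F : FilteredSpace X n) : Prop :=
  ∀ i A, F.IsStratum i A →
    IsTopologicalManifold A i ∧ ∃ O : Set X, IsOpen O ∧ A = O ∩ F.layer i

/-- A CS set of dimension `n`. -/
def IsCSSet (F : FilteredSpace X n) : Prop :=
  T2Space X ∧ F.HasManifoldStrata ∧
  ∀ i, i < n → ∀ x : F.layer i,
    ∃ (V : Set X) (U : Set (F.layer i)), IsOpen V ∧ (x : X) ∈ V ∧ IsOpen U ∧ x ∈ U ∧
    ∃ (l : ℕ) (L : Type u) (_ : TopologicalSpace L) (_ : Nonempty L) (_ : CompactSpace L)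
      (_ : T2Space L) (G : FilteredSpace L l), i + l + 1 = n ∧
    ∃ φ : (U × OpenCone L) ≃ₜ V,
      (G.cone.prod U).IsStratifiedHomeo (F.induced V) φ ∧
      ∀ y : U, ((φ (y, OpenCone.apex) : V) : X) = ((y : F.layer i) : X)

/-- The continuous map `π : E → A`, defined on an open neighborhood `E` of the
`i`-dimensional singular stratum `A`, is a conical neighborhood of `A` with link the compact
filtered space `(L, G)`: there is a conical trivialization consisting of an open cover `𝔘`
of `A` and, for each `U ∈ 𝔘`, a stratified homeomorphism `φ_U` from `π⁻¹(U)` to `U × cL` with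
`pr₁ ∘ φ_U = π` and `φ_U(x) = (x, apex)` for `x ∈ U`. -/
def IsConicalNeighborhood (F : FilteredSpace X n) (i : ℕ) (A E : Set X) (π : E → A)
    {l : ℕ} {L : Type u} [TopologicalSpace L] [Nonempty L] (G : FilteredSpace L l) : Prop :=
  F.IsStratum i A ∧ i + l + 1 = n ∧ CompactSpace L ∧ T2Space L ∧
  IsOpen E ∧ A ⊆ E ∧ Continuous π ∧
  ∃ 𝔘 : Set (Set A), (∀ U ∈ 𝔘, IsOpen U) ∧ ⋃₀ 𝔘 = univ ∧
    ∀ U ∈ 𝔘, ∃ φ : (π ⁻¹' U : Set E) ≃ₜ (U × OpenCone L),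
      ((F.induced E).induced (π ⁻¹' U)).IsStratifiedHomeo (G.cone.prod U) φ ∧
      (∀ y : (π ⁻¹' U : Set E), ((φ y).1 : A) = π (y : E)) ∧
      ∀ x : U, (((φ.symm (x, OpenCone.apex) : (π ⁻¹' U : Set E)) : E) : X) = ((x : A) : X)

/-- A pre-Thom–Mather space of dimension `n`: every singular stratum has a conical
neighborhood. -/
def IsPreThomMather (F : FilteredSpace X n) : Prop :=
  T2Space X ∧ F.HasManifoldStrata ∧
  ∀ i A, i < n → F.IsStratum i A →
    ∃ (E : Set X) (π : E → A) (l : ℕ) (L : Type u) (_ : TopologicalSpace L) (_ : Nonempty L)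
      (G : FilteredSpace L l), F.IsConicalNeighborhood i A E π G

/-! ### Coarsenings -/

/-- `(X, S, T)` is a coarsening: each stratum of `T` is a union of strata of `S`. -/
def IsCoarsening (S T : FilteredSpace X n) : Prop :=
  ∀ i A, T.IsStratum i A →
    ∃ 𝒞 : Set (Set X), (∀ B ∈ 𝒞, ∃ j, S.IsStratum j B) ∧ A = ⋃₀ 𝒞

/-- `(X, S, T)` is a CS-coarsening. -/
def IsCSCoarsening (S T : FilteredSpace X n) : Prop :=
  S.IsCSSet ∧ T.IsCSSet ∧ IsCoarsening S T

/-- `A` is an exceptional stratum: a singular stratum of `S` contained in a regular stratum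
of `T`. -/
def IsExceptional (S T : FilteredSpace X n) (A : Set X) : Prop :=
  (∃ i, i < n ∧ S.IsStratum i A) ∧ ∃ B, T.IsStratum n B ∧ A ⊆ B

theorem mem_prevSkel_iff_of_isCoarsening {S T : FilteredSpace X n} (h : IsCoarsening S T)
    {j : ℕ} (hj : j < n) {A : Set X} (hA : S.IsStratum j A) {x : X} (hx : x ∈ A) :
    x ∈ T.prevSkel n ↔ ¬ IsExceptional S T A := by
  constructor
  · rintro hxT ⟨_, B, hB, hAB⟩
    exact (hB.subset_layer (hAB hx)).2 hxT
  · intro hne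
    by_contra hxT
    apply hne
    have hl : x ∈ T.layer n := ⟨T.skel_top ▸ mem_univ x, hxT⟩
    have hst : T.IsStratum n (connectedComponentIn (T.layer n) x) := ⟨x, hl, rfl⟩
    refine ⟨⟨j, hj, hA⟩, _, hst, ?_⟩
    obtain ⟨𝒞, h𝒞, hU⟩ := h n _ hst
    have hxU : x ∈ ⋃₀ 𝒞 := hU ▸ mem_connectedComponentIn hl
    obtain ⟨C, hC, hxC⟩ := hxU
    obtain ⟨k, hk⟩ := h𝒞 C hC
    have hkj : k = j := by
      have h1 := hk.subset_layer hxC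
      have h2 := hA.subset_layer hx
      rcases lt_trichotomy k j with hlt | heq | hlt
      · exact absurd ⟨k, hlt, h1.1⟩ h2.2
      · exact heq
      · exact absurd ⟨j, hlt, h2.1⟩ h1.2
    subst hkj
    have hAC : A = C := by
      obtain ⟨a, ha, rfl⟩ := hA
      obtain ⟨c, hc, rfl⟩ := hk
      rw [connectedComponentIn_eq hx, connectedComponentIn_eq hxC]
    rw [hAC, hU]
    exact subset_sUnion_of_mem hC

/-- The filtration `S_e` obtained by merging the exceptional strata into the regular part:
for `i < n`, its `i`-th skeleton is the union of the non-exceptional strata of `S` of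
dimension at most `i`; its `n`-th skeleton is `X`. -/
def mergeExceptional (S T : FilteredSpace X n) (h : IsCoarsening S T) : FilteredSpace X n where
  skel i := {x | i < n → ∃ j ≤ i, ∃ A, S.IsStratum j A ∧ ¬ IsExceptional S T A ∧ x ∈ A}
  isClosed_skel i := by
    by_cases hi : i < n
    · have heq : {x | i < n → ∃ j ≤ i, ∃ A, S.IsStratum j A ∧ ¬ IsExceptional S T A ∧ x ∈ A}
          = S.skel i ∩ T.prevSkel n := by
        ext x
        constructor
        · intro hx
          obtain ⟨j, hj, A, hA, hne, hxA⟩ := hx hi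
          exact ⟨S.mono_skel hj (hA.subset_layer hxA).1,
            (mem_prevSkel_iff_of_isCoarsening h (hj.trans_lt hi) hA hxA).2 hne⟩
        · rintro ⟨hxS, hxT⟩ -
          obtain ⟨j, hj, A, hA, hxA⟩ := S.exists_isStratum hxS
          exact ⟨j, hj, A, hA,
            (mem_prevSkel_iff_of_isCoarsening h (hj.trans_lt hi) hA hxA).1 hxT, hxA⟩
      rw [heq]
      exact (S.isClosed_skel i).inter (T.isClosed_prevSkel n)
    · have heq : {x | i < n → ∃ j ≤ i, ∃ A, S.IsStratum j A ∧ ¬ IsExceptional S T A ∧ x ∈ A}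
          = univ := eq_univ_of_forall fun x hlt => absurd hlt hi
      rw [heq]
      exact isClosed_univ
  mono_skel := by
    intro i k hik x hx hk
    obtain ⟨j, hj, hA⟩ := hx (lt_of_le_of_lt hik hk)
    exact ⟨j, hj.trans hik, hA⟩
  skel_top := eq_univ_of_forall fun x hlt => absurd hlt (lt_irrefl n)
  prevSkel_ne := by
    intro hcon
    apply S.prevSkel_ne
    refine eq_univ_of_forall fun x => ?_
    have hx : x ∈ (univ : Set X) := mem_univ x
    rw [← hcon] at hx
    obtain ⟨i, hi, hxi⟩ := hx
    obtain ⟨j, hj, A, hA, _, hxA⟩ := hxi hi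
    exact ⟨j, hj.trans_lt hi, (hA.subset_layer hxA).1⟩

/-- The equivalence relation on the strata of `S` generated by `A ∼ B` whenever `A` is
exceptional and `A ≤ B`, i.e. `A ⊆ closure B`. -/
def MergeRel (S T : FilteredSpace X n) : {A : Set X // ∃ i, S.IsStratum i A} →
    {A : Set X // ∃ i, S.IsStratum i A} → Prop :=
  Relation.EqvGen fun A B => IsExceptional S T A.1 ∧ A.1 ⊆ closure B.1

end FilteredSpace

/-! A filtration is handled through the dimension `dim` of its points; a stratified homeomorphism is
then a homeomorphism preserving codimension. The regular part of the CS set `T` is dense and the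
regular strata of `S` are open, so regular points of `S` are regular in `T`. Hence `S_e` has the
strata of `T` on the regular part of `T` and the strata of `S` on the closed set R = `T.prevSkel n`,
a union of strata of `S`. The coarsenings, the manifold strata and the list of singular strata
follow from this.

Two points need the cones. In a conical chart with connected base, horizontal slices and rays
without their apex stay in one stratum. A stratum therefore lies in the closure of every stratum
meeting its conical neighborhood (`subset_closure_stratum`), so an exceptional stratum is related to
all strata near it, and connectedness of a regular stratum of `T` makes all strata of `S` inside it
equivalent.

For the conical neighborhoods, R meets each fibre in a subcone. Its shape may depend on the chart,
but correcting charts by transition homeomorphisms, along the connected stratum, makes it one fixed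
C (`exists_subcone`). Merging the points of the link off C into its regular part turns these charts
for `S` into charts for `S_e`. -/

/-! ### Filtrations through the dimension of points -/

namespace Filtration

variable {X : Type u} [TopologicalSpace X] {n : ℕ}

/-- The dimension of the layer containing `x`. -/
noncomputable def dim (F : Filtration X n) (x : X) : ℕ := sInf {i | x ∈ F.skel i}

theorem mem_skel_iff (F : Filtration X n) {x : X} {i : ℕ} : x ∈ F.skel i ↔ F.dim x ≤ i := by
  constructor
  · intro h
    exact Nat.sInf_le h
  · intro h
    have h1 : F.dim x ∈ {i | x ∈ F.skel i} :=
      Nat.sInf_mem ⟨n, by rw [mem_ofPred_eq, F.skel_top]; trivial⟩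
    exact F.mono_skel h h1

theorem mem_prevSkel_iff (F : Filtration X n) {x : X} {i : ℕ} :
    x ∈ F.prevSkel i ↔ F.dim x < i := by
  constructor
  · rintro ⟨j, hj, hx⟩
    exact (F.mem_skel_iff.1 hx).trans_lt hj
  · intro h
    exact ⟨_, h, F.mem_skel_iff.2 le_rfl⟩

theorem mem_layer_iff (F : Filtration X n) {x : X} {i : ℕ} : x ∈ F.layer i ↔ F.dim x = i := by
  rw [layer, mem_sdiff, F.mem_skel_iff, F.mem_prevSkel_iff]
  omega

theorem dim_le (F : Filtration X n) (x : X) : F.dim x ≤ n := by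
  rw [← F.mem_skel_iff, F.skel_top]; trivial

theorem dim_eq_of_forall_mem_skel_iff {F : Filtration X n} {x : X} {d : ℕ}
    (h : ∀ i, x ∈ F.skel i ↔ d ≤ i) : F.dim x = d :=
  le_antisymm (F.mem_skel_iff.1 ((h d).2 le_rfl)) ((h _).1 (F.mem_skel_iff.2 le_rfl))

/-- The stratum through `x`. -/
def stratum (F : Filtration X n) (x : X) : Set X := connectedComponentIn (F.layer (F.dim x)) x

theorem mem_layer_dim (F : Filtration X n) (x : X) : x ∈ F.layer (F.dim x) :=
  F.mem_layer_iff.2 rfl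

theorem mem_stratum (F : Filtration X n) (x : X) : x ∈ F.stratum x :=
  mem_connectedComponentIn (F.mem_layer_dim x)

theorem isStratum_stratum (F : Filtration X n) (x : X) : F.IsStratum (F.dim x) (F.stratum x) :=
  ⟨x, F.mem_layer_dim x, rfl⟩

theorem isPreconnected_stratum (F : Filtration X n) (x : X) : IsPreconnected (F.stratum x) :=
  isPreconnected_connectedComponentIn

theorem dim_eq_of_mem_stratum {F : Filtration X n} {x y : X} (h : y ∈ F.stratum x) :
    F.dim y = F.dim x :=
  F.mem_layer_iff.1 (connectedComponentIn_subset _ _ h)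

theorem stratum_eq_of_mem {F : Filtration X n} {x y : X} (h : y ∈ F.stratum x) :
    F.stratum y = F.stratum x := by
  rw [stratum, dim_eq_of_mem_stratum h]
  exact (connectedComponentIn_eq h).symm

theorem IsStratum.dim_eq {F : Filtration X n} {i : ℕ} {A : Set X} (h : F.IsStratum i A) {x : X}
    (hx : x ∈ A) : F.dim x = i :=
  F.mem_layer_iff.1 (h.subset_layer hx)

theorem IsStratum.eq_stratum {F : Filtration X n} {i : ℕ} {A : Set X} (h : F.IsStratum i A)
    {x : X} (hx : x ∈ A) : A = F.stratum x := by
  have hd := h.dim_eq hx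
  obtain ⟨a, ha, rfl⟩ := h
  rw [stratum, hd]
  exact connectedComponentIn_eq hx

theorem IsStratum.nonempty {F : Filtration X n} {i : ℕ} {A : Set X} (h : F.IsStratum i A) :
    A.Nonempty := by
  obtain ⟨a, ha, rfl⟩ := h
  exact ⟨a, mem_connectedComponentIn ha⟩

theorem isStratum_iff {F : Filtration X n} {i : ℕ} {A : Set X} :
    F.IsStratum i A ↔ ∃ x, F.dim x = i ∧ A = F.stratum x := by
  constructor
  · intro h
    obtain ⟨x, hx⟩ := h.nonempty
    exact ⟨x, h.dim_eq hx, h.eq_stratum hx⟩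
  · rintro ⟨x, rfl, rfl⟩
    exact F.isStratum_stratum x

theorem subset_stratum {F : Filtration X n} {C : Set X} (hC : IsPreconnected C) {x : X}
    (hx : x ∈ C) (h : ∀ y ∈ C, F.dim y = F.dim x) : C ⊆ F.stratum x :=
  hC.subset_connectedComponentIn hx fun y hy => F.mem_layer_iff.2 (h y hy)

theorem isOpen_layer_top (F : Filtration X n) : IsOpen (F.layer n) := by
  rw [layer, F.skel_top]
  exact isOpen_univ.sdiff (F.isClosed_prevSkel n)

theorem dim_induced (F : Filtration X n) (Y : Set X) (y : Y) : (F.induced Y).dim y = F.dim y :=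
  dim_eq_of_forall_mem_skel_iff fun _ => F.mem_skel_iff

theorem dim_prod {Y : Type v} [TopologicalSpace Y] (F : Filtration X n) (p : Y × X) :
    (F.prod Y).dim p = F.dim p.2 :=
  dim_eq_of_forall_mem_skel_iff fun _ => F.mem_skel_iff

theorem mem_cone_skel_iff (F : Filtration X n) {i : ℕ} (p : X × Ico (0 : ℝ) 1) :
    OpenCone.mk p ∈ F.cone.skel i ↔ (p.2 : ℝ) = 0 ∨ p.1 ∈ F.prevSkel i := by
  constructor
  · rintro ⟨q, hpq, hq⟩
    rcases OpenCone.mk_eq_mk.1 hpq with rfl | h0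
    · exact hq
    · exact Or.inl h0.1
  · intro hp
    exact ⟨p, rfl, hp⟩

theorem dim_cone_of_eq_zero (F : Filtration X n) {p : X × Ico (0 : ℝ) 1} (h : (p.2 : ℝ) = 0) :
    F.cone.dim (OpenCone.mk p) = 0 :=
  dim_eq_of_forall_mem_skel_iff fun i => by simp [mem_cone_skel_iff, h]

theorem dim_cone_of_ne_zero (F : Filtration X n) {p : X × Ico (0 : ℝ) 1} (h : (p.2 : ℝ) ≠ 0) :
    F.cone.dim (OpenCone.mk p) = F.dim p.1 + 1 :=
  dim_eq_of_forall_mem_skel_iff fun i => by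
    simp [mem_cone_skel_iff, h, mem_prevSkel_iff]

theorem IsStratifiedMap.codim_le {Y : Type v} [TopologicalSpace Y] {m : ℕ} {F : Filtration X n}
    {G : Filtration Y m} {f : X → Y} (h : F.IsStratifiedMap G f) (x : X) :
    m - G.dim (f x) ≤ n - F.dim x := by
  obtain ⟨j, B, hB, hfB, hj⟩ := h.2 _ _ (F.isStratum_stratum x)
  rwa [hB.dim_eq (hfB (mem_image_of_mem f (F.mem_stratum x)))]

/-- The image of a stratum is connected and of constant dimension, hence lies in a single stratum.
-/
theorem isStratifiedMap_of_codim_eq {Y : Type v} [TopologicalSpace Y] {m : ℕ}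
    {F : Filtration X n} {G : Filtration Y m} {f : X → Y} (hf : Continuous f)
    (h : ∀ x, n - F.dim x = m - G.dim (f x)) : F.IsStratifiedMap G f := by
  refine ⟨hf, fun i A hA => ?_⟩
  obtain ⟨x, rfl, rfl⟩ := isStratum_iff.1 hA
  refine ⟨_, _, G.isStratum_stratum (f x), ?_, (h x).ge⟩
  refine subset_stratum ((F.isPreconnected_stratum x).image f hf.continuousOn)
    (mem_image_of_mem f (F.mem_stratum x)) ?_
  rintro _ ⟨y, hy, rfl⟩
  have h1 := h x
  have h2 := h y
  rw [dim_eq_of_mem_stratum hy] at h2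
  have h3 := G.dim_le (f x)
  have h4 := G.dim_le (f y)
  omega

/-- A stratified homeomorphism is a homeomorphism preserving the codimension of points. -/
theorem isStratifiedHomeo_iff {Y : Type v} [TopologicalSpace Y] {m : ℕ} {F : Filtration X n}
    {G : Filtration Y m} {f : X ≃ₜ Y} :
    F.IsStratifiedHomeo G f ↔ ∀ x, n - F.dim x = m - G.dim (f x) := by
  constructor
  · rintro ⟨h1, h2⟩ x
    refine le_antisymm ?_ (h1.codim_le x)
    simpa using h2.codim_le (f x)
  · intro h
    refine ⟨isStratifiedMap_of_codim_eq f.continuous h,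
      isStratifiedMap_of_codim_eq f.symm.continuous fun y => ?_⟩
    simpa using (h (f.symm y)).symm

end Filtration

/-! ### Rays of the open cone -/

namespace OpenCone

variable {L : Type u}

theorem mk_eq_apex [Nonempty L] {p : L × Ico (0 : ℝ) 1} (h : (p.2 : ℝ) = 0) :
    mk p = apex :=
  mk_eq_mk.2 (Or.inr ⟨h, rfl⟩)

theorem continuous_mk [TopologicalSpace L] :
    Continuous (mk : L × Ico (0 : ℝ) 1 → OpenCone L) :=
  continuous_quot_mk

theorem exists_eq_mk (z : OpenCone L) : ∃ p : L × Ico (0 : ℝ) 1, z = mk p := by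
  obtain ⟨p, rfl⟩ := Quotient.exists_rep z
  exact ⟨p, rfl⟩

/-- Along each ray of the open cone, the apex is a limit of points distinct from the apex. -/
theorem apex_mem_closure_ray [TopologicalSpace L] [Nonempty L] {Y : Type v} [TopologicalSpace Y]
    {f : OpenCone L → Y} (hf : Continuous f) (p : L) {B : Set Y}
    (h : ∀ t : Ico (0 : ℝ) 1, (t : ℝ) ≠ 0 → f (mk (p, t)) ∈ B) : f apex ∈ closure B := by
  have h0 : (⟨0, by norm_num, by norm_num⟩ : Ico (0 : ℝ) 1) ∈
      closure {t : Ico (0 : ℝ) 1 | (t : ℝ) ≠ 0} := by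
    rw [mem_closure_iff_seq_limit]
    -- The shift by 2 keeps the first term below 1.
    refine ⟨fun k => ⟨1 / ((k : ℝ) + 2), by positivity, ?_⟩, fun k => ?_, ?_⟩
    · rw [div_lt_one (by positivity)]
      have : (0 : ℝ) ≤ k := Nat.cast_nonneg k
      linarith
    · have : (0 : ℝ) < 1 / ((k : ℝ) + 2) := by positivity
      exact this.ne'
    · rw [tendsto_subtype_rng]
      have := (tendsto_one_div_add_atTop_nhds_zero_nat (𝕜 := ℝ)).comp (Filter.tendsto_add_atTop_nat 1)
      refine this.congr fun k => ?_
      simp only [Function.comp, Nat.cast_add, Nat.cast_one]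
      ring
  have hc : Continuous fun t : Ico (0 : ℝ) 1 => f (mk (p, t)) :=
    hf.comp (continuous_mk.comp (by fun_prop))
  have := map_mem_closure hc h0 (t := B) fun t ht => h t ht
  rwa [mk_eq_apex rfl] at this

/-- Serves to keep a ray, deprived of the apex, inside one stratum. -/
theorem isPreconnected_ray [TopologicalSpace L] (p : L) :
    IsPreconnected {z : OpenCone L | ∃ t : Ico (0 : ℝ) 1, (t : ℝ) ≠ 0 ∧ z = mk (p, t)} := by
  have h1 : IsPreconnected {t : Ico (0 : ℝ) 1 | (t : ℝ) ≠ 0} := by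
    rw [← Topology.IsInducing.subtypeVal.isPreconnected_image]
    convert (isPreconnected_Ioo : IsPreconnected (Ioo (0 : ℝ) 1)) using 1
    ext t
    constructor
    · rintro ⟨s, hs, rfl⟩
      exact ⟨lt_of_le_of_ne s.2.1 (Ne.symm hs), s.2.2⟩
    · rintro ht
      exact ⟨⟨t, ht.1.le, ht.2⟩, ht.1.ne', rfl⟩
  convert h1.image (fun t => mk (p, t)) (continuous_mk.comp (by fun_prop)).continuousOn using 1
  ext z
  constructor
  · rintro ⟨t, ht, rfl⟩
    exact ⟨t, ht, rfl⟩
  · rintro ⟨t, ht, rfl⟩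
    exact ⟨t, ht, rfl⟩

end OpenCone

/-! ### Conical charts -/

/-- The homeomorphism `φ` is a conical chart over `U` of the map `π : E → A`: it preserves
codimensions, lies over `U`, and is the standard embedding of `U` along the apex. -/
structure IsConicalChart {X : Type u} [TopologicalSpace X] {n : ℕ} (F : Filtration X n)
    {A E : Set X} (π : E → A) {L : Type u} [TopologicalSpace L] [Nonempty L] {l : ℕ}
    (G : Filtration L l) (U : Set A) (φ : (π ⁻¹' U : Set E) ≃ₜ (U × OpenCone L)) : Prop where
  codim_eq : ∀ y : (π ⁻¹' U : Set E), n - F.dim ((y : E) : X) = (l + 1) - G.cone.dim (φ y).2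
  fst_eq : ∀ y : (π ⁻¹' U : Set E), ((φ y).1 : A) = π (y : E)
  apex_eq : ∀ x : U, (((φ.symm (x, OpenCone.apex) : (π ⁻¹' U : Set E)) : E) : X) = ((x : A) : X)

namespace IsConicalChart

open Filtration

variable {X : Type u} [TopologicalSpace X] {n : ℕ} {F : Filtration X n}
  {A E : Set X} {π : E → A} {L : Type u} [TopologicalSpace L] [Nonempty L] {l : ℕ}
  {G : Filtration L l} {U : Set A} {φ : (π ⁻¹' U : Set E) ≃ₜ (U × OpenCone L)}

theorem proj_symm (h : IsConicalChart F π G U φ) (p : U × OpenCone L) :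
    π (φ.symm p : E) = p.1 := by
  rw [← h.fst_eq, φ.apply_symm_apply]

theorem codim_symm (h : IsConicalChart F π G U φ) (p : U × OpenCone L) :
    n - F.dim ((φ.symm p : E) : X) = (l + 1) - G.cone.dim p.2 := by
  rw [h.codim_eq, φ.apply_symm_apply]

/-- Allows the base of a chart to be shrunk to a connected open set. -/
theorem restrict (h : IsConicalChart F π G U φ) {U' : Set A} (hU : U' ⊆ U) :
    ∃ ψ : (π ⁻¹' U' : Set E) ≃ₜ (U' × OpenCone L), IsConicalChart F π G U' ψ := by
  have hmem : ∀ p : U' × OpenCone L,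
      (φ.symm (⟨p.1, hU p.1.2⟩, p.2) : E) ∈ π ⁻¹' U' := fun p => by
    rw [mem_preimage, h.proj_symm]
    exact p.1.2
  refine ⟨{ toFun := fun y => ((⟨φ ⟨y.1, hU y.2⟩ |>.1, by rw [h.fst_eq]; exact y.2⟩ : U'),
              (φ ⟨y.1, hU y.2⟩).2)
            invFun := fun p => ⟨φ.symm (⟨p.1, hU p.1.2⟩, p.2), hmem p⟩
            left_inv := fun y => by simp
            right_inv := fun p => by simp
            continuous_toFun := by fun_prop
            continuous_invFun := by fun_prop }, ⟨fun y => ?_, fun y => ?_, fun x => ?_⟩⟩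
  · exact h.codim_eq ⟨y.1, hU y.2⟩
  · exact h.fst_eq ⟨y.1, hU y.2⟩
  · exact h.apex_eq ⟨x, hU x.2⟩

/-- Changing a conical chart by a codimension preserving self-homeomorphism of the cone. -/
theorem trans (h : IsConicalChart F π G U φ) (g : OpenCone L ≃ₜ OpenCone L)
    (hg : ∀ z, (l + 1) - G.cone.dim z = (l + 1) - G.cone.dim (g z))
    (hg0 : g OpenCone.apex = OpenCone.apex) :
    IsConicalChart F π G U (φ.trans ((Homeomorph.refl U).prodCongr g)) where
  codim_eq y := (h.codim_eq y).trans (hg _)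
  fst_eq y := h.fst_eq y
  apex_eq x := by
    have : g.symm OpenCone.apex = OpenCone.apex := by rw [g.symm_apply_eq, hg0]
    have h2 : (φ.trans ((Homeomorph.refl U).prodCongr g)).symm (x, OpenCone.apex) =
        φ.symm (x, g.symm OpenCone.apex) := rfl
    rw [h2, this]
    exact h.apex_eq x

/-- Two conical charts over sets sharing a point differ there by a codimension preserving
self-homeomorphism of the cone. -/
theorem exists_transition (h : IsConicalChart F π G U φ) {U' : Set A}
    {ψ : (π ⁻¹' U' : Set E) ≃ₜ (U' × OpenCone L)} (h' : IsConicalChart F π G U' ψ) {a : A}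
    (ha : a ∈ U) (ha' : a ∈ U') :
    ∃ g : OpenCone L ≃ₜ OpenCone L,
      (∀ z, (l + 1) - G.cone.dim z = (l + 1) - G.cone.dim (g z)) ∧
      g OpenCone.apex = OpenCone.apex ∧
      ∀ z, (ψ.symm (⟨a, ha'⟩, g z) : E) = (φ.symm (⟨a, ha⟩, z) : E) := by
  -- Both charts lie over `π`, so they parametrize the same fibre over `a`. Stating this for an
  -- arbitrary ordered pair of charts yields the inverse by exchanging their roles.
  have key : ∀ {U U' : Set A} {φ : (π ⁻¹' U : Set E) ≃ₜ (U × OpenCone L)}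
      {ψ : (π ⁻¹' U' : Set E) ≃ₜ (U' × OpenCone L)} (h : IsConicalChart F π G U φ)
      (h' : IsConicalChart F π G U' ψ) (ha : a ∈ U) (ha' : a ∈ U'),
      ∃ g : OpenCone L → OpenCone L, Continuous g ∧
        ∀ z, (ψ.symm (⟨a, ha'⟩, g z) : E) = (φ.symm (⟨a, ha⟩, z) : E) := by
    intro U U' φ ψ h h' ha ha'
    have hmem : ∀ z, (φ.symm (⟨a, ha⟩, z) : E) ∈ π ⁻¹' U' := fun z => by
      rw [mem_preimage, h.proj_symm]
      exact ha'
    refine ⟨fun z => (ψ ⟨φ.symm (⟨a, ha⟩, z), hmem z⟩).2, by fun_prop, fun z => ?_⟩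
    have : ((⟨a, ha'⟩ : U'), (ψ ⟨φ.symm (⟨a, ha⟩, z), hmem z⟩).2) =
        ψ ⟨φ.symm (⟨a, ha⟩, z), hmem z⟩ := by
      refine Prod.ext (Subtype.ext ?_) rfl
      rw [h'.fst_eq]
      exact (h.proj_symm (⟨a, ha⟩, z)).symm
    rw [this, ψ.symm_apply_apply]
  obtain ⟨g, hgc, hg⟩ := key h h' ha ha'
  obtain ⟨g', hgc', hg'⟩ := key h' h ha' ha
  have inj : ∀ {U : Set A} (φ : (π ⁻¹' U : Set E) ≃ₜ (U × OpenCone L)) (u : U) (z w),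
      (φ.symm (u, z) : E) = (φ.symm (u, w) : E) → z = w := by
    intro U φ u z w hzw
    exact (Prod.ext_iff.1 (φ.symm.injective (Subtype.ext hzw))).2
  refine ⟨⟨⟨g, g', fun z => inj φ ⟨a, ha⟩ _ _ ?_, fun z => inj ψ ⟨a, ha'⟩ _ _ ?_⟩, hgc, hgc'⟩,
    fun z => ?_, inj ψ ⟨a, ha'⟩ _ _ ?_, hg⟩
  · rw [hg', hg]
  · rw [hg, hg']
  · have h1 := h.codim_symm (⟨a, ha⟩, z)
    have h2 := h'.codim_symm (⟨a, ha'⟩, g z)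
    rw [hg, h1] at h2
    exact h2
  · refine (hg _).trans (Subtype.ext ?_)
    rw [h.apex_eq, h'.apex_eq]

/-- The slice `U × {z}` is connected, and its codimension is that of `z` in the cone. -/
theorem stratum_symm_eq_of_fst (h : IsConicalChart F π G U φ) (hU : IsPreconnected U)
    (u u' : U) (z : OpenCone L) :
    F.stratum ((φ.symm (u, z) : E) : X) = F.stratum ((φ.symm (u', z) : E) : X) := by
  have : PreconnectedSpace U := isPreconnected_iff_preconnectedSpace.1 hU
  have hpre : IsPreconnected (range fun w : U => ((φ.symm (w, z) : E) : X)) :=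
    isPreconnected_range (by fun_prop)
  refine stratum_eq_of_mem (subset_stratum hpre ⟨u', rfl⟩ ?_ ⟨u, rfl⟩)
  rintro _ ⟨w, rfl⟩
  have h1 := h.codim_symm (w, z)
  have h2 := h.codim_symm (u', z)
  -- These bounds make the truncated codimensions determine the dimensions.
  have h3 := F.dim_le ((φ.symm (w, z) : E) : X)
  have h4 := F.dim_le ((φ.symm (u', z) : E) : X)
  simp only at h1 h2 ⊢
  omega

theorem stratum_symm_eq_of_ray (h : IsConicalChart F π G U φ) (u : U) (p : L)
    {s t : Ico (0 : ℝ) 1} (hs : (s : ℝ) ≠ 0) (ht : (t : ℝ) ≠ 0) :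
    F.stratum ((φ.symm (u, OpenCone.mk (p, s)) : E) : X) =
      F.stratum ((φ.symm (u, OpenCone.mk (p, t)) : E) : X) := by
  have hc : Continuous fun z => ((φ.symm (u, z) : E) : X) := by fun_prop
  have hpre := (OpenCone.isPreconnected_ray p).image _ hc.continuousOn
  refine stratum_eq_of_mem (subset_stratum hpre ⟨_, ⟨t, ht, rfl⟩, rfl⟩ ?_
    ⟨_, ⟨s, hs, rfl⟩, rfl⟩)
  rintro _ ⟨_, ⟨r, hr, rfl⟩, rfl⟩
  have h1 := h.codim_symm (u, OpenCone.mk (p, r))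
  have h2 := h.codim_symm (u, OpenCone.mk (p, t))
  rw [dim_cone_of_ne_zero _ (by exact hr)] at h1
  rw [dim_cone_of_ne_zero _ (by exact ht)] at h2
  have h3 := F.dim_le ((φ.symm (u, OpenCone.mk (p, r)) : E) : X)
  have h4 := F.dim_le ((φ.symm (u, OpenCone.mk (p, t)) : E) : X)
  simp only at h1 h2 ⊢
  omega

/-- Over a connected chart, the base is in the closure of each stratum met by the chart. -/
theorem mem_closure_stratum (h : IsConicalChart F π G U φ) (hU : IsPreconnected U) {y : E}
    (hy : π y ∈ U) {a : A} (ha : a ∈ U) : (a : X) ∈ closure (F.stratum y) := by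
  obtain ⟨u, z, hz⟩ : ∃ u z, φ ⟨y, hy⟩ = (u, z) := ⟨_, _, rfl⟩
  have hy' : y = (φ.symm (u, z) : E) := by rw [← hz, φ.symm_apply_apply]
  -- The point is moved horizontally into the fibre over `a`; its ray then leads to the apex, which
  -- is `a`.
  rw [hy', h.stratum_symm_eq_of_fst hU u ⟨a, ha⟩]
  obtain ⟨⟨p, t⟩, rfl⟩ := z.exists_eq_mk
  by_cases ht : (t : ℝ) = 0
  · rw [OpenCone.mk_eq_apex ht]
    have h1 := h.apex_eq ⟨a, ha⟩
    rw [h1]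
    exact subset_closure (F.mem_stratum _)
  · have h1 := h.apex_eq ⟨a, ha⟩
    rw [show (a : X) = _ from h1.symm]
    refine OpenCone.apex_mem_closure_ray
      (f := fun z => ((φ.symm ((⟨a, ha⟩ : U), z) : E) : X)) (by fun_prop) p fun s hs => ?_
    rw [h.stratum_symm_eq_of_ray ⟨a, ha⟩ p ht hs]
    exact F.mem_stratum _

end IsConicalChart

theorem IsTopologicalManifold.locallyConnectedSpace {M : Type u} [TopologicalSpace M] {d : ℕ}
    (h : IsTopologicalManifold M d) : LocallyConnectedSpace M := by
  obtain ⟨_, _, ⟨_⟩⟩ := h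
  exact ChartedSpace.locallyConnectedSpace (EuclideanSpace ℝ (Fin d)) M

namespace FilteredSpace

open Filtration

variable {X : Type u} [TopologicalSpace X] {n : ℕ}

/-! ### Conical neighborhoods of strata -/

section ConicalNeighborhood

variable {S : FilteredSpace X n} {i : ℕ} {A E : Set X} {π : E → A}
  {l : ℕ} {L : Type u} [TopologicalSpace L] [Nonempty L] {G : FilteredSpace L l}

theorem isConicalNeighborhood_iff :
    S.IsConicalNeighborhood i A E π G ↔
      S.IsStratum i A ∧ i + l + 1 = n ∧ CompactSpace L ∧ T2Space L ∧
      IsOpen E ∧ A ⊆ E ∧ Continuous π ∧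
      ∀ a : A, ∃ U : Set A, IsOpen U ∧ a ∈ U ∧
        ∃ φ, IsConicalChart S.toFiltration π G.toFiltration U φ := by
  have key : ∀ (U : Set A) (φ : (π ⁻¹' U : Set E) ≃ₜ (U × OpenCone L)),
      (((S.induced E).induced (π ⁻¹' U)).IsStratifiedHomeo (G.cone.prod U) φ ∧
      (∀ y : (π ⁻¹' U : Set E), ((φ y).1 : A) = π (y : E)) ∧
      ∀ x : U, (((φ.symm (x, OpenCone.apex) : (π ⁻¹' U : Set E)) : E) : X) = ((x : A) : X)) ↔
      IsConicalChart S.toFiltration π G.toFiltration U φ := by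
    intro U φ
    rw [isStratifiedHomeo_iff]
    simp only [dim_induced, dim_prod]
    exact ⟨fun h => ⟨h.1, h.2.1, h.2.2⟩, fun h => ⟨h.1, h.2, h.3⟩⟩
  simp only [IsConicalNeighborhood, key]
  refine and_congr_right' <| and_congr_right' <| and_congr_right' <| and_congr_right' <|
    and_congr_right' <| and_congr_right' <| and_congr_right' ?_
  constructor
  · rintro ⟨𝔘, ho, hc, h⟩ a
    obtain ⟨U, hU, haU⟩ : a ∈ ⋃₀ 𝔘 := hc ▸ mem_univ a
    exact ⟨U, ho U hU, haU, h U hU⟩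
  · intro h
    refine ⟨{U | IsOpen U ∧ ∃ φ, IsConicalChart S.toFiltration π G.toFiltration U φ},
      fun U hU => hU.1, eq_univ_of_forall fun a => ?_, fun U hU => hU.2⟩
    obtain ⟨U, ho, ha, hφ⟩ := h a
    exact ⟨U, ⟨ho, hφ⟩, ha⟩

/-- The stratum is a manifold, hence locally connected. -/
theorem IsConicalNeighborhood.exists_preconnected_chart (hS : S.HasManifoldStrata)
    (h : S.IsConicalNeighborhood i A E π G) (a : A) :
    ∃ U : Set A, IsOpen U ∧ a ∈ U ∧ IsPreconnected U ∧
      ∃ φ, IsConicalChart S.toFiltration π G.toFiltration U φ := by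
  obtain ⟨hA, -, -, -, -, -, -, hc⟩ := isConicalNeighborhood_iff.1 h
  obtain ⟨U, ho, ha, φ, hφ⟩ := hc a
  have := (hS i A hA).1.locallyConnectedSpace
  obtain ⟨U', hU', ho', ha', hc'⟩ :=
    locallyConnectedSpace_iff_subsets_isOpen_isConnected.1 this a U (ho.mem_nhds ha)
  exact ⟨U', ho', ha', hc'.isPreconnected, hφ.restrict hU'⟩

theorem IsConicalNeighborhood.preconnectedSpace (h : S.IsConicalNeighborhood i A E π G) :
    PreconnectedSpace A := by
  obtain ⟨x, -, rfl⟩ := isStratum_iff.1 h.1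
  exact isPreconnected_iff_preconnectedSpace.1 (S.isPreconnected_stratum x)

/-- A stratum having a conical neighborhood lies in the closure of each stratum meeting
this neighborhood. -/
theorem IsConicalNeighborhood.subset_closure_stratum (hS : S.HasManifoldStrata)
    (h : S.IsConicalNeighborhood i A E π G) (y : E) : A ⊆ closure (S.stratum y) := by
  have hpre := h.preconnectedSpace
  obtain ⟨-, -, -, -, hE, hAE, hπ, -⟩ := isConicalNeighborhood_iff.1 h
  have hpc := h.exists_preconnected_chart hS
  have hbase : ((π y : A) : X) ∈ closure (S.stratum y) := by
    obtain ⟨U, -, ha, hU, φ, hφ⟩ := hpc (π y)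
    exact hφ.mem_closure_stratum hU ha ha
  -- Closure membership spreads over a chart: if `b` is in the closure, the stratum meets the open
  -- set `π⁻¹(U)`, and so accumulates at every point of `U`.
  have hloc : ∀ a : A, ∃ U : Set A, IsOpen U ∧ a ∈ U ∧
      ∀ b ∈ U, (b : X) ∈ closure (S.stratum y) → ∀ c ∈ U, (c : X) ∈ closure (S.stratum y) := by
    intro a
    obtain ⟨U, hUo, ha, hU, φ, hφ⟩ := hpc a
    refine ⟨U, hUo, ha, fun b hb hby c hc => ?_⟩
    -- The apex section shows that `π` is a retraction onto `A`.
    have hbE : π ⟨b, hAE b.2⟩ = b := by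
      have h1 := hφ.apex_eq ⟨b, hb⟩
      have h2 := hφ.proj_symm (⟨b, hb⟩, OpenCone.apex)
      rw [show (⟨b, hAE b.2⟩ : E) = (φ.symm (⟨b, hb⟩, OpenCone.apex) : E) from
        Subtype.ext h1.symm, h2]
    have hopen : IsOpen (Subtype.val '' (π ⁻¹' U) : Set X) :=
      hE.isOpenMap_subtype_val _ (hUo.preimage hπ)
    obtain ⟨x, ⟨x', hx', rfl⟩, hxy⟩ := mem_closure_iff.1 hby _ hopen
      ⟨⟨b, hAE b.2⟩, by rw [mem_preimage, hbE]; exact hb, rfl⟩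
    rw [← stratum_eq_of_mem hxy]
    exact hφ.mem_closure_stratum hU hx' hc
  have hind := fun a b : A => (isPreconnected_univ (α := A)).induction₂
    (fun a b : A => (a : X) ∈ closure (S.stratum y) ↔ (b : X) ∈ closure (S.stratum y))
    (fun a _ => by
      obtain ⟨U, hUo, ha, hU⟩ := hloc a
      rw [nhdsWithin_univ]
      filter_upwards [hUo.mem_nhds ha] with b hb
      exact ⟨fun hh => hU a ha hh b hb, fun hh => hU b hb hh a ha⟩)
    (fun a b c _ _ _ => Iff.trans) (fun a b _ _ => Iff.symm) (mem_univ a) (mem_univ b)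
  intro a ha
  exact (hind (π y) ⟨a, ha⟩).1 hbase

/-- A closed union of strata containing `A` is, in suitable conical charts, the product of the
base with a subcone which does not depend on the chart. -/
theorem IsConicalNeighborhood.exists_subcone (hS : S.HasManifoldStrata)
    (h : S.IsConicalNeighborhood i A E π G) {R : Set X} (hR : IsClosed R)
    (hRS : ∀ x y, S.stratum x = S.stratum y → x ∈ R → y ∈ R) (hAR : A ⊆ R) :
    ∃ C : Set (OpenCone L), IsClosed C ∧ OpenCone.apex ∈ C ∧
      (∀ (p : L) (s t : Ico (0 : ℝ) 1), (s : ℝ) ≠ 0 → (t : ℝ) ≠ 0 →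
        OpenCone.mk (p, s) ∈ C → OpenCone.mk (p, t) ∈ C) ∧
      ∀ a : A, ∃ U : Set A, IsOpen U ∧ a ∈ U ∧
        ∃ φ, IsConicalChart S.toFiltration π G.toFiltration U φ ∧
          ∀ u z, ((φ.symm (u, z) : E) : X) ∈ R ↔ z ∈ C := by
  have hpre := h.preconnectedSpace
  have hpc := h.exists_preconnected_chart hS
  obtain ⟨a₀, ha₀⟩ := h.1.nonempty
  have hchart : ∀ {U : Set A} {φ : (π ⁻¹' U : Set E) ≃ₜ (U × OpenCone L)},
      IsPreconnected U → IsConicalChart S.toFiltration π G.toFiltration U φ → ∀ u u' z,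
      ((φ.symm (u, z) : E) : X) ∈ R ↔ ((φ.symm (u', z) : E) : X) ∈ R := by
    intro U φ hU hφ u u' z
    exact ⟨hRS _ _ (hφ.stratum_symm_eq_of_fst hU u u' z),
      hRS _ _ (hφ.stratum_symm_eq_of_fst hU u' u z)⟩
  obtain ⟨U₀, ho₀, hau₀, hc₀, φ₀, hφ₀⟩ := hpc ⟨a₀, ha₀⟩
  let u₀ : U₀ := ⟨⟨a₀, ha₀⟩, hau₀⟩
  -- The model subcone is the trace of `R` on the fibre over a base point; all other charts are
  -- adjusted to it.
  let C : Set (OpenCone L) := {z | ((φ₀.symm (u₀, z) : E) : X) ∈ R}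
  refine ⟨C, ?_, ?_, fun p s t hs ht => ?_, ?_⟩
  · exact hR.preimage (f := fun z => ((φ₀.symm (u₀, z) : E) : X)) (by fun_prop)
  · change ((φ₀.symm (u₀, OpenCone.apex) : E) : X) ∈ R
    rw [hφ₀.apex_eq]
    exact hAR ha₀
  · exact hRS _ _ (hφ₀.stratum_symm_eq_of_ray u₀ p hs ht)
  let P : Set A → Prop := fun U => IsOpen U ∧
    ∃ φ : (π ⁻¹' U : Set E) ≃ₜ (U × OpenCone L),
      IsConicalChart S.toFiltration π G.toFiltration U φ ∧
      ∀ u z, ((φ.symm (u, z) : E) : X) ∈ R ↔ z ∈ C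
  -- Composing `φ` with the transition at `a` matches the trace of `R` over `a` with `C`; since `U`
  -- is connected, the same holds over all of `U`.
  have hstep : ∀ {U U' : Set A} {a : A}, IsOpen U → IsPreconnected U → a ∈ U →
      (∃ φ, IsConicalChart S.toFiltration π G.toFiltration U φ) → P U' → a ∈ U' → P U := by
    rintro U U' a ho hU ha ⟨φ, hφ⟩ ⟨-, ψ, hψ, hψC⟩ ha'
    obtain ⟨g, hg, hg0, hgψ⟩ := hφ.exists_transition hψ ha ha'
    refine ⟨ho, _, hφ.trans g hg hg0, fun u z => ?_⟩
    change ((φ.symm (u, g.symm z) : E) : X) ∈ R ↔ z ∈ C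
    rw [hchart hU hφ u ⟨a, ha⟩, ← hgψ, g.apply_symm_apply, hψC]
  have hind := fun a b : A => (isPreconnected_univ (α := A)).induction₂
    (fun a b : A => (∃ U, P U ∧ a ∈ U) ↔ (∃ U, P U ∧ b ∈ U))
    (fun a _ => by
      obtain ⟨U, hUo, ha, hU, hφ⟩ := hpc a
      rw [nhdsWithin_univ]
      filter_upwards [hUo.mem_nhds ha] with b hb
      exact ⟨fun ⟨U', hU', ha'⟩ => ⟨U, hstep hUo hU ha hφ hU' ha', hb⟩,
        fun ⟨U', hU', hb'⟩ => ⟨U, hstep hUo hU hb hφ hU' hb', ha⟩⟩)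
    (fun a b c _ _ _ => Iff.trans) (fun a b _ _ => Iff.symm) (mem_univ a) (mem_univ b)
  intro a
  obtain ⟨U, ⟨ho, hφ⟩, ha⟩ := (hind ⟨a₀, ha₀⟩ a).1
    ⟨U₀, ⟨ho₀, φ₀, hφ₀, fun u z => hchart hc₀ hφ₀ u u₀ z⟩, hau₀⟩
  exact ⟨U, ho, ha, hφ⟩

end ConicalNeighborhood

/-! ### Refiltering the link; density of the regular part -/

/-- The filtration of the link obtained by merging into the regular part the points lying
outside a closed set `C`. -/
def mergeOutside {L : Type u} [TopologicalSpace L] {l : ℕ} (G : FilteredSpace L l) (C : Set L)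
    (hC : IsClosed C) : FilteredSpace L l where
  skel i := {x | i < l → x ∈ G.skel i ∩ C}
  isClosed_skel i := by
    by_cases hi : i < l
    · convert (G.isClosed_skel i).inter hC using 1
      ext x
      simp [hi]
    · simp [hi]
  mono_skel := fun i j hij x hx hj =>
    ⟨G.mono_skel hij (hx (hij.trans_lt hj)).1, (hx (hij.trans_lt hj)).2⟩
  skel_top := eq_univ_of_forall fun x hlt => absurd hlt (lt_irrefl l)
  prevSkel_ne := by
    intro hcon
    refine G.prevSkel_ne (eq_univ_of_forall fun x => ?_)
    obtain ⟨j, hj, hx⟩ := hcon.symm ▸ mem_univ x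
    exact ⟨j, hj, (hx hj).1⟩

theorem dim_mergeOutside_of_mem {L : Type u} [TopologicalSpace L] {l : ℕ}
    (G : FilteredSpace L l) {C : Set L} (hC : IsClosed C) {x : L} (hx : x ∈ C) :
    (G.mergeOutside C hC).dim x = G.dim x :=
  dim_eq_of_forall_mem_skel_iff fun i => by
    change (i < l → x ∈ G.skel i ∩ C) ↔ _
    rw [mem_inter_iff, G.mem_skel_iff, and_iff_left hx]
    have := G.dim_le x
    omega

theorem dim_mergeOutside_of_notMem {L : Type u} [TopologicalSpace L] {l : ℕ}
    (G : FilteredSpace L l) {C : Set L} (hC : IsClosed C) {x : L} (hx : x ∉ C) :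
    (G.mergeOutside C hC).dim x = l :=
  dim_eq_of_forall_mem_skel_iff fun i => by
    change (i < l → x ∈ G.skel i ∩ C) ↔ _
    simp [hx]

/-- The regular part of a CS set is dense. -/
theorem IsCSSet.dense_layer {T : FilteredSpace X n} (hT : T.IsCSSet) : Dense (T.layer n) := by
  intro x
  rcases (T.dim_le x).eq_or_lt with hx | hx
  · exact subset_closure (T.mem_layer_iff.2 hx)
  obtain ⟨V, U, -, -, -, hxU, l, L, _, _, _, _, G, hl, φ, hφ, hφ0⟩ :=
    hT.2.2 _ hx ⟨x, T.mem_layer_dim x⟩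
  rw [isStratifiedHomeo_iff] at hφ
  -- Over a regular point of the link, the ray consists of regular points and tends to `x`.
  obtain ⟨p, hp⟩ := (ne_univ_iff_exists_notMem _).1 G.prevSkel_ne
  have hp' : G.dim p = l := by
    rw [mem_prevSkel_iff] at hp
    have := G.dim_le p
    omega
  let u : U := ⟨⟨x, T.mem_layer_dim x⟩, hxU⟩
  have h0 : ((φ (u, OpenCone.apex) : V) : X) = x := hφ0 u
  rw [← h0]
  refine OpenCone.apex_mem_closure_ray (f := fun z => ((φ (u, z) : V) : X)) (by fun_prop) p
    fun t ht => ?_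
  have h1 := hφ (u, OpenCone.mk (p, t))
  rw [dim_prod, dim_induced, dim_cone_of_ne_zero _ (by exact ht), hp'] at h1
  have h2 := T.dim_le (φ (u, OpenCone.mk (p, t)) : X)
  rw [mem_layer_iff]
  omega

/-! ### Points and strata of the merged filtration -/

section Coarsening

variable {S T : FilteredSpace X n}

theorem IsCoarsening.stratum_subset (h : IsCoarsening S T) (x : X) :
    S.stratum x ⊆ T.stratum x := by
  obtain ⟨𝒞, h𝒞, hU⟩ := h _ _ (T.isStratum_stratum x)
  obtain ⟨B, hB, hxB⟩ : x ∈ ⋃₀ 𝒞 := hU ▸ T.mem_stratum x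
  obtain ⟨j, hj⟩ := h𝒞 B hB
  rw [← hj.eq_stratum hxB, hU]
  exact subset_sUnion_of_mem hB

theorem isCoarsening_of_stratum_subset (h : ∀ x, S.stratum x ⊆ T.stratum x) :
    IsCoarsening S T := by
  intro i A hA
  obtain ⟨x, rfl, rfl⟩ := isStratum_iff.1 hA
  refine ⟨S.stratum '' T.stratum x, ?_, ?_⟩
  · rintro _ ⟨y, -, rfl⟩
    exact ⟨_, S.isStratum_stratum y⟩
  · ext y
    constructor
    · intro hy
      exact ⟨_, ⟨y, hy, rfl⟩, S.mem_stratum y⟩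
    · rintro ⟨_, ⟨z, hz, rfl⟩, hy⟩
      rw [← stratum_eq_of_mem hz]
      exact h z hy

theorem IsCoarsening.stratum_eq (h : IsCoarsening S T) {x y : X}
    (hxy : S.stratum x = S.stratum y) : T.stratum x = T.stratum y :=
  stratum_eq_of_mem (h.stratum_subset y (hxy ▸ S.mem_stratum x))

theorem IsCoarsening.dim_eq (h : IsCoarsening S T) {x y : X}
    (hxy : S.stratum x = S.stratum y) : T.dim x = T.dim y :=
  dim_eq_of_mem_stratum (h.stratum_subset y (hxy ▸ S.mem_stratum x))

theorem HasManifoldStrata.isOpen_stratum (hS : S.HasManifoldStrata) {x : X}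
    (hx : S.dim x = n) : IsOpen (S.stratum x) := by
  obtain ⟨-, O, hO, h⟩ := hS _ _ (S.isStratum_stratum x)
  rw [h, hx]
  exact hO.inter S.isOpen_layer_top

/-- Regular points of `S` are regular points of `T`. -/
theorem IsCSCoarsening.dim_eq_top (h : IsCSCoarsening S T) {x : X} (hx : S.dim x = n) :
    T.dim x = n := by
  -- The open stratum of `x` meets the dense regular part of `T`, and the dimension in `T` is
  -- constant along strata of `S`.
  obtain ⟨y, hyT, hyS⟩ := h.2.1.dense_layer.exists_mem_open (h.1.2.1.isOpen_stratum hx)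
    ⟨x, S.mem_stratum x⟩
  rw [← h.2.2.dim_eq (stratum_eq_of_mem hyS), T.mem_layer_iff.1 hyT]

theorem isExceptional_stratum_iff (h : IsCoarsening S T) {x : X} :
    IsExceptional S T (S.stratum x) ↔ S.dim x < n ∧ T.dim x = n := by
  constructor
  · rintro ⟨⟨i, hi, hA⟩, B, hB, hAB⟩
    exact ⟨(hA.dim_eq (S.mem_stratum x)).trans_lt hi, hB.dim_eq (hAB (S.mem_stratum x))⟩
  · rintro ⟨h1, h2⟩
    refine ⟨⟨_, h1, S.isStratum_stratum x⟩, T.stratum x, ?_, h.stratum_subset x⟩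
    simpa only [h2] using T.isStratum_stratum x

theorem IsCSCoarsening.dim_mergeExceptional_of_lt (h : IsCSCoarsening S T) {x : X}
    (hx : T.dim x < n) : (S.mergeExceptional T h.2.2).dim x = S.dim x := by
  have hSx : S.dim x < n :=
    lt_of_le_of_ne (S.dim_le x) fun h' => hx.ne (h.dim_eq_top h')
  refine dim_eq_of_forall_mem_skel_iff fun i => ?_
  constructor
  · intro hi
    by_contra hlt
    obtain ⟨j, hj, A, hA, -, hxA⟩ := hi ((not_le.1 hlt).trans hSx)
    exact hlt ((hA.dim_eq hxA).le.trans hj)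
  · intro hi _
    refine ⟨_, hi, _, S.isStratum_stratum x, fun he => ?_, S.mem_stratum x⟩
    exact hx.ne ((isExceptional_stratum_iff h.2.2).1 he).2

theorem IsCSCoarsening.dim_mergeExceptional_of_eq (h : IsCSCoarsening S T) {x : X}
    (hx : T.dim x = n) : (S.mergeExceptional T h.2.2).dim x = n := by
  refine dim_eq_of_forall_mem_skel_iff fun i => ?_
  constructor
  · intro hi
    by_contra hlt
    obtain ⟨j, hj, A, hA, hne, hxA⟩ := hi (not_le.1 hlt)
    rw [hA.eq_stratum hxA] at hne
    refine hne ((isExceptional_stratum_iff h.2.2).2 ⟨?_, hx⟩)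
    rw [hA.dim_eq hxA]
    exact hj.trans_lt (not_le.1 hlt)
  · intro hi hlt
    exact absurd hi (not_le.2 hlt)

/-- A singular point of `T` is singular in `S` and keeps its dimension, so it cannot become regular.
-/
theorem IsCSCoarsening.layer_mergeExceptional_top (h : IsCSCoarsening S T) :
    (S.mergeExceptional T h.2.2).layer n = T.layer n := by
  ext x
  rw [mem_layer_iff, mem_layer_iff]
  refine ⟨fun hx => ?_, h.dim_mergeExceptional_of_eq⟩
  by_contra hne
  have hlt := lt_of_le_of_ne (T.dim_le x) hne
  rw [h.dim_mergeExceptional_of_lt hlt] at hx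
  exact hne (h.dim_eq_top hx)

theorem IsCSCoarsening.stratum_mergeExceptional_of_eq (h : IsCSCoarsening S T) {x : X}
    (hx : T.dim x = n) : (S.mergeExceptional T h.2.2).stratum x = T.stratum x := by
  rw [stratum, stratum, h.dim_mergeExceptional_of_eq hx, hx, h.layer_mergeExceptional_top]

theorem IsCSCoarsening.layer_mergeExceptional_subset (h : IsCSCoarsening S T) {i : ℕ}
    (hi : i < n) : (S.mergeExceptional T h.2.2).layer i ⊆ S.layer i := by
  intro x hx
  rw [mem_layer_iff] at hx ⊢
  rcases (T.dim_le x).eq_or_lt with hT | hT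
  · rw [h.dim_mergeExceptional_of_eq hT] at hx
    omega
  · rwa [h.dim_mergeExceptional_of_lt hT] at hx

theorem IsCSCoarsening.dim_lt (h : IsCSCoarsening S T) {x : X} (hx : T.dim x < n) :
    S.dim x < n :=
  lt_of_le_of_ne (S.dim_le x) fun h' => hx.ne (h.dim_eq_top h')

/-- Each side is connected and of constant dimension for the other filtration: a stratum of `S`
never mixes regular and singular points of `T`. -/
theorem IsCSCoarsening.stratum_mergeExceptional_of_lt (h : IsCSCoarsening S T) {x : X}
    (hx : T.dim x < n) : (S.mergeExceptional T h.2.2).stratum x = S.stratum x := by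
  have hd := h.dim_mergeExceptional_of_lt hx
  have hSx := h.dim_lt hx
  apply Subset.antisymm
  · refine subset_stratum (isPreconnected_stratum _ x) (mem_stratum _ x) fun y hy => ?_
    refine S.mem_layer_iff.1 (h.layer_mergeExceptional_subset hSx ?_)
    rw [mem_layer_iff, dim_eq_of_mem_stratum hy, hd]
  · refine subset_stratum (S.isPreconnected_stratum x) (S.mem_stratum x) fun y hy => ?_
    have hy' : T.dim y < n := by rwa [h.2.2.dim_eq (stratum_eq_of_mem hy)]
    rw [hd, h.dim_mergeExceptional_of_lt hy', dim_eq_of_mem_stratum hy]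

theorem IsCSCoarsening.isCoarsening_mergeExceptional (h : IsCSCoarsening S T) :
    IsCoarsening S (S.mergeExceptional T h.2.2) :=
  isCoarsening_of_stratum_subset fun x => by
    rcases (T.dim_le x).eq_or_lt with hT | hT
    · rw [h.stratum_mergeExceptional_of_eq hT]
      exact h.2.2.stratum_subset x
    · rw [h.stratum_mergeExceptional_of_lt hT]

theorem IsCSCoarsening.mergeExceptional_isCoarsening (h : IsCSCoarsening S T) :
    IsCoarsening (S.mergeExceptional T h.2.2) T :=
  isCoarsening_of_stratum_subset fun x => by
    rcases (T.dim_le x).eq_or_lt with hT | hT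
    · rw [h.stratum_mergeExceptional_of_eq hT]
    · rw [h.stratum_mergeExceptional_of_lt hT]
      exact h.2.2.stratum_subset x

theorem IsCSCoarsening.isStratum_mergeExceptional_iff (h : IsCSCoarsening S T) {i : ℕ}
    (hi : i < n) {A : Set X} : (S.mergeExceptional T h.2.2).IsStratum i A ↔
      S.IsStratum i A ∧ ¬ IsExceptional S T A := by
  constructor
  · intro hA
    obtain ⟨x, rfl, rfl⟩ := isStratum_iff.1 hA
    have hx : T.dim x < n := by
      refine lt_of_le_of_ne (T.dim_le x) fun hT => ?_
      exact hi.ne (h.dim_mergeExceptional_of_eq hT)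
    rw [h.dim_mergeExceptional_of_lt hx, h.stratum_mergeExceptional_of_lt hx]
    refine ⟨S.isStratum_stratum x, fun he => ?_⟩
    exact hx.ne ((isExceptional_stratum_iff h.2.2).1 he).2
  · rintro ⟨hA, hne⟩
    obtain ⟨x, rfl, rfl⟩ := isStratum_iff.1 hA
    have hx : T.dim x < n := by
      refine lt_of_le_of_ne (T.dim_le x) fun hT => ?_
      exact hne ((isExceptional_stratum_iff h.2.2).2 ⟨hi, hT⟩)
    rw [← h.dim_mergeExceptional_of_lt hx, ← h.stratum_mergeExceptional_of_lt hx]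
    exact isStratum_stratum _ x

theorem IsCSCoarsening.hasManifoldStrata_mergeExceptional (h : IsCSCoarsening S T) :
    (S.mergeExceptional T h.2.2).HasManifoldStrata := by
  intro i A hA
  rcases hA.le.eq_or_lt with rfl | hi
  · rw [h.layer_mergeExceptional_top]
    refine h.2.1.2.1 i A ?_
    obtain ⟨x, hx, rfl⟩ := hA
    rw [h.layer_mergeExceptional_top] at hx ⊢
    exact ⟨x, hx, rfl⟩
  · obtain ⟨hm, O, hO, hAO⟩ := h.1.2.1 i A ((h.isStratum_mergeExceptional_iff hi).1 hA).1
    -- Below dimension `n` the layers only shrink, so the open set given by `S` still works.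
    refine ⟨hm, O, hO, Subset.antisymm (fun x hx => ⟨?_, hA.subset_layer hx⟩) ?_⟩
    · rw [hAO] at hx
      exact hx.1
    · rintro x ⟨hxO, hx⟩
      rw [hAO]
      exact ⟨hxO, h.layer_mergeExceptional_subset hi hx⟩

/-! ### Conical neighborhoods in the merged filtration -/

/-- The conical neighborhoods in `S` of the singular strata of `S_e` are conical neighborhoods
in `S_e`, for some filtration of the link. -/
theorem IsCSCoarsening.isConicalNeighborhood_mergeExceptional (h : IsCSCoarsening S T) {i : ℕ}
    {A E : Set X} {π : E → A} {l : ℕ} {L : Type u} [TopologicalSpace L] [Nonempty L]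
    {G : FilteredSpace L l} (hi : i < n) (hA : (S.mergeExceptional T h.2.2).IsStratum i A)
    (hG : S.IsConicalNeighborhood i A E π G) :
    ∃ G' : FilteredSpace L l,
      (S.mergeExceptional T h.2.2).IsConicalNeighborhood i A E π G' := by
  have hAR : A ⊆ T.prevSkel n := by
    intro a ha
    rw [mem_prevSkel_iff_of_isCoarsening h.2.2 hi hG.1 ha]
    exact ((h.isStratum_mergeExceptional_iff hi).1 hA).2
  obtain ⟨C, hC, hC0, hray, hchart⟩ := hG.exists_subcone h.1.2.1 (T.isClosed_prevSkel n)
    (fun x y hxy hx => by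
      rw [mem_prevSkel_iff] at hx ⊢
      rwa [← h.2.2.dim_eq hxy]) hAR
  -- Any nonzero height would do: off the apex, membership in `C` is constant along rays.
  let t₀ : Ico (0 : ℝ) 1 := ⟨1 / 2, by norm_num, by norm_num⟩
  have ht₀ : (t₀ : ℝ) ≠ 0 := by norm_num [t₀]
  have hcl : IsClosed {p : L | OpenCone.mk (p, t₀) ∈ C} :=
    hC.preimage (OpenCone.continuous_mk.comp (by fun_prop))
  obtain ⟨-, hl, hcomp, hT2, hE, hAE, hπ, -⟩ := isConicalNeighborhood_iff.1 hG
  refine ⟨G.mergeOutside _ hcl, isConicalNeighborhood_iff.2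
    ⟨hA, hl, hcomp, hT2, hE, hAE, hπ, fun a => ?_⟩⟩
  obtain ⟨U, ho, ha, φ, hφ, hφC⟩ := hchart a
  refine ⟨U, ho, ha, φ, ⟨fun y => ?_, hφ.fst_eq, hφ.apex_eq⟩⟩
  have hy := hφ.codim_eq y
  have hyC : ((y : E) : X) ∈ T.prevSkel n ↔ (φ y).2 ∈ C := by
    rw [← hφC (φ y).1, Prod.mk.eta, φ.symm_apply_apply]
  rw [mem_prevSkel_iff] at hyC
  obtain ⟨⟨p, t⟩, hz⟩ := (φ y).2.exists_eq_mk
  rw [hz] at hy hyC ⊢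
  by_cases ht : (t : ℝ) = 0
  · rw [OpenCone.mk_eq_apex ht] at hyC
    rw [h.dim_mergeExceptional_of_lt (hyC.2 hC0), hy, dim_cone_of_eq_zero _ (by exact ht),
      dim_cone_of_eq_zero _ (by exact ht)]
  rw [dim_cone_of_ne_zero _ (by exact ht)] at hy ⊢
  by_cases hp : OpenCone.mk (p, t) ∈ C
  · rw [h.dim_mergeExceptional_of_lt (hyC.2 hp), hy,
      dim_mergeOutside_of_mem _ _ (by exact hray p t t₀ ht ht₀ hp)]
  -- Off `C` both codimensions are 0: the point is regular in `T`, and its ray comes from a merged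
  -- point of the link.
  · have hT : T.dim ((y : E) : X) = n :=
      le_antisymm (T.dim_le _) (not_lt.1 fun h' => hp (hyC.1 h'))
    rw [h.dim_mergeExceptional_of_eq hT,
      dim_mergeOutside_of_notMem _ _ (by exact fun h' => hp (hray p t₀ t ht₀ ht h'))]
    simp

/-! ### Equivalence classes of strata -/

/-- Equivalent strata of `S` lie in the same stratum of `S_e`. -/
theorem IsCSCoarsening.stratum_eq_of_mergeRel (h : IsCSCoarsening S T)
    {B C : {A : Set X // ∃ i, S.IsStratum i A}} (hBC : MergeRel S T B C) :
    ∀ b ∈ B.1, ∀ c ∈ C.1,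
      (S.mergeExceptional T h.2.2).stratum b = (S.mergeExceptional T h.2.2).stratum c := by
  induction hBC with
  | rel B C hBC =>
    intro b hb c hc
    obtain ⟨B, j, hB⟩ := B
    obtain ⟨C, k, hCk⟩ := C
    obtain ⟨he, hcl⟩ := hBC
    simp only at hb hc he hcl
    rw [hB.eq_stratum hb, isExceptional_stratum_iff h.2.2] at he
    -- The regular stratum of `T` through `b` is open, so it meets `C`, which then lies entirely in
    -- it.
    obtain ⟨c', hc'T, hc'⟩ := mem_closure_iff.1 (hcl hb) _ (h.2.1.2.1.isOpen_stratum he.2)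
      (T.mem_stratum b)
    have hcc : S.stratum c = S.stratum c' := by
      rw [← hCk.eq_stratum hc, ← hCk.eq_stratum hc']
    have hbc : T.stratum c = T.stratum b :=
      (h.2.2.stratum_eq hcc).trans (stratum_eq_of_mem hc'T)
    have hc0 : T.dim c = n := by
      rw [dim_eq_of_mem_stratum (hbc ▸ T.mem_stratum c), he.2]
    rw [h.stratum_mergeExceptional_of_eq he.2, h.stratum_mergeExceptional_of_eq hc0, hbc]
  | refl B =>
    intro b hb c hc
    obtain ⟨j, hB⟩ := B.2
    refine h.isCoarsening_mergeExceptional.stratum_eq ?_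
    rw [← hB.eq_stratum hb, ← hB.eq_stratum hc]
  | symm B C _ ih => exact fun b hb c hc => (ih c hc b hb).symm
  | trans B C D _ _ ih1 ih2 =>
    intro b hb d hd
    obtain ⟨c, hc⟩ := C.2.choose_spec.nonempty
    exact (ih1 b hb c hc).trans (ih2 c hc d hd)

/-- Inside a regular stratum of `T` the relation is locally constant, so connectedness concludes.
Near a regular point of `S` the stratum does not change; near an exceptional one, the conical
neighborhood meets only strata whose closure contains the exceptional stratum. -/
theorem IsCSCoarsening.mergeRel_of_mem_stratum (h : IsCSCoarsening S T)
    (hS : S.IsPreThomMather) {x y : X} (hy : y ∈ (S.mergeExceptional T h.2.2).stratum x) :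
    MergeRel S T ⟨S.stratum x, _, S.isStratum_stratum x⟩
      ⟨S.stratum y, _, S.isStratum_stratum y⟩ := by
  rcases (T.dim_le x).eq_or_lt with hx | hx
  · rw [h.stratum_mergeExceptional_of_eq hx] at hy
    refine (T.isPreconnected_stratum x).induction₂
      (fun x y => MergeRel S T ⟨S.stratum x, _, S.isStratum_stratum x⟩
        ⟨S.stratum y, _, S.isStratum_stratum y⟩) (fun z hz => ?_)
      (fun a b c _ _ _ => Relation.EqvGen.trans _ _ _) (fun a b _ _ => Relation.EqvGen.symm _ _)
      (T.mem_stratum x) hy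
    apply mem_nhdsWithin_of_mem_nhds
    rcases (S.dim_le z).eq_or_lt with hzn | hzn
    · filter_upwards [(hS.2.1.isOpen_stratum hzn).mem_nhds (S.mem_stratum z)] with w hw
      have : (⟨S.stratum w, _, S.isStratum_stratum w⟩ : {A : Set X // ∃ i, S.IsStratum i A}) =
          ⟨S.stratum z, _, S.isStratum_stratum z⟩ := Subtype.ext (stratum_eq_of_mem hw)
      rw [this]
      exact Relation.EqvGen.refl _
    · obtain ⟨E, π, l, L, _, _, G, hG⟩ := hS.2.2 _ _ hzn (S.isStratum_stratum z)
      obtain ⟨-, -, -, -, hE, hAE, -⟩ := id hG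
      filter_upwards [hE.mem_nhds (hAE (S.mem_stratum z))] with w hw
      refine Relation.EqvGen.rel _ _ ⟨(isExceptional_stratum_iff h.2.2).2 ⟨hzn, ?_⟩,
        hG.subset_closure_stratum hS.2.1 ⟨w, hw⟩⟩
      rw [dim_eq_of_mem_stratum hz, hx]
  · rw [h.stratum_mergeExceptional_of_lt hx] at hy
    have : (⟨S.stratum y, _, S.isStratum_stratum y⟩ : {A : Set X // ∃ i, S.IsStratum i A}) =
        ⟨S.stratum x, _, S.isStratum_stratum x⟩ := Subtype.ext (stratum_eq_of_mem hy)
    rw [this]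
    exact Relation.EqvGen.refl _

theorem IsCSCoarsening.stratum_mergeExceptional_eq_iUnion (h : IsCSCoarsening S T)
    (hS : S.IsPreThomMather) (x : X) : (S.mergeExceptional T h.2.2).stratum x =
      ⋃ C ∈ {C | MergeRel S T ⟨S.stratum x, _, S.isStratum_stratum x⟩ C}, C.1 := by
  ext y
  simp only [mem_iUnion, mem_ofPred_eq]
  constructor
  · intro hy
    exact ⟨_, h.mergeRel_of_mem_stratum hS hy, S.mem_stratum y⟩
  · rintro ⟨C, hC, hy⟩
    rw [h.stratum_eq_of_mergeRel hC x (S.mem_stratum x) y hy]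
    exact mem_stratum _ y

end Coarsening

end FilteredSpace

theorem proposition6p3 {X : Type u} [TopologicalSpace X] {n : ℕ} (S T : FilteredSpace X n)
    (hST : FilteredSpace.IsCSCoarsening S T) (hS : S.IsPreThomMather) :
    -- `S_e` decomposes the coarsening `(X, S, T)`
    FilteredSpace.IsCoarsening S (S.mergeExceptional T hST.2.2) ∧
    FilteredSpace.IsCoarsening (S.mergeExceptional T hST.2.2) T ∧
    -- the strata of `S_e` are the unions of the classes of strata of `S`
    (∀ A : Set X, (∃ i, (S.mergeExceptional T hST.2.2).IsStratum i A) ↔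
      ∃ B : {B : Set X // ∃ i, S.IsStratum i B},
        A = ⋃ C ∈ {C | FilteredSpace.MergeRel S T B C}, C.1) ∧
    -- `S_e` is pre-Thom–Mather
    (S.mergeExceptional T hST.2.2).IsPreThomMather ∧
    -- the singular strata of `S_e` are the non-exceptional singular strata of `S`
    (∀ (i : ℕ) (A : Set X), i < n →
      ((S.mergeExceptional T hST.2.2).IsStratum i A ↔
        S.IsStratum i A ∧ ¬ FilteredSpace.IsExceptional S T A)) ∧
    -- a conical neighborhood in `(X, S)` of a singular stratum of `S_e` is also one in
    -- `(X, S_e)`, for some filtration of the same link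
    (∀ (i : ℕ) (A : Set X), i < n → (S.mergeExceptional T hST.2.2).IsStratum i A →
      ∀ (E : Set X) (π : E → A) (l : ℕ) (L : Type u) [TopologicalSpace L] [Nonempty L]
        (G : FilteredSpace L l), S.IsConicalNeighborhood i A E π G →
        ∃ G' : FilteredSpace L l,
          (S.mergeExceptional T hST.2.2).IsConicalNeighborhood i A E π G') := by
  have hstr := hST.stratum_mergeExceptional_eq_iUnion hS
  refine ⟨hST.isCoarsening_mergeExceptional, hST.mergeExceptional_isCoarsening, fun A => ?_,
    ⟨hS.1, hST.hasManifoldStrata_mergeExceptional, fun i A hi hA => ?_⟩,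
    fun i A hi => hST.isStratum_mergeExceptional_iff hi,
    fun i A hi hA E π l L _ _ G hG => hST.isConicalNeighborhood_mergeExceptional hi hA hG⟩
  · constructor
    · rintro ⟨i, hA⟩
      obtain ⟨x, -, rfl⟩ := Filtration.isStratum_iff.1 hA
      exact ⟨_, hstr x⟩
    · rintro ⟨⟨B, j, hB⟩, rfl⟩
      obtain ⟨x, rfl, rfl⟩ := Filtration.isStratum_iff.1 hB
      rw [← hstr x]
      exact ⟨_, Filtration.isStratum_stratum _ x⟩
  · obtain ⟨E, π, l, L, _, _, G, hG⟩ :=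
      hS.2.2 i A hi ((hST.isStratum_mergeExceptional_iff hi).1 hA).1
    obtain ⟨G', hG'⟩ := hST.isConicalNeighborhood_mergeExceptional hi hA hG
    exact ⟨E, π, l, L, _, _, G', hG'⟩
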